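/- Let $d\ge 1$ and $1\le p\le\infty$. Let $\mathbb S^d\subset\mathbb R^{d+1}$ be the unit sphere with surface measure $\sigma$ and geodesic distance $d(u,v)=\arccos\langle u,v\rangle$. For $\ell\ge 0$ let $\mathcal H_\ell$ be the space of (complex) spherical harmonics of degree $\ell$, i.e. the restrictions to $\mathbb S^d$ of the homogeneous harmonic polynomials of degree $\ell$ on $\mathbb R^{d+1}$, and let $\Pi_L$ be the linear span of $\mathcal H_0,\dots,\mathcal H_L$; its dimension is $\pi_L=\frac{d+2L}{d}\binom{d+L-1}{L}$. A triangular family is a collection $\mathcal Z=\{z_{Lj}\in\mathbb S^d : L\ge 0,\ 1\le j\le m_L\}$ with $m_L\to\infty$ as $L\to\infty$. It is called $L^p$-interpolating if $m_L\le\pi_L$ for all $L$ and if for every family of complex values $\{c_{Lj}\}_{L\ge 0,\,1\le j\le m_L}$ such that $$\sup_{L\ge 0}\frac1{\pi_L}\sum_{j=1}^{m_L}|c_{Lj}|^p<\infty\quad(1\le p<\infty),\qquad \sup_{L,j}|c_{Lj}|<\infty\quad(p=\infty),$$ there are polynomials $Q_L\in\Pi_L$, $L\ge 0$, such that $\sup_{L\ge0}\|Q_L\|_{L^p(\mathbb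 S^d,\sigma)}<\infty$ and $Q_L(z_{Lj})=c_{Lj}$ for all $L\ge 0$ and $1\le j\le m_L$. **Theorem.** If $\mathcal Z$ is an $L^p$-interpolating triangular family, then $\mathcal Z$ is uniformly separated: there is $\varepsilon>0$ such that $$d(z_{Lj},z_{Lk})\ge\frac{\varepsilon}{L+1}\qquad\text{for all } L\ge 0 \text{ and all } 1\le j,k\le m_L \text{ with } j\ne k.$$ -/

import Mathlib

open MeasureTheory
open scoped ENNReal

noncomputable section

namespace SphericalInterpolation

/-- The unit sphere of `ℝ^{d+1}`. -/
abbrev Sph (d : ℕ) : Type :=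
  Metric.sphere (0 : EuclideanSpace ℝ (Fin (d + 1))) 1

/-- The Lebesgue surface measure of the sphere. -/
def surface (d : ℕ) : Measure (Sph d) :=
  (volume : Measure (EuclideanSpace ℝ (Fin (d + 1)))).toSphere

/-- The geodesic distance `arccos ⟨u, v⟩`. -/
def geoDist {d : ℕ} (u v : Sph d) : ℝ :=
  Real.arccos (inner ℝ (u : EuclideanSpace ℝ (Fin (d + 1))) (v : EuclideanSpace ℝ (Fin (d + 1))))

/-- The Laplacian on polynomials in `d + 1` variables. -/
def polyLaplacian (d : ℕ) :
    MvPolynomial (Fin (d + 1)) ℂ →ₗ[ℂ] MvPolynomial (Fin (d + 1)) ℂ :=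
  ∑ i : Fin (d + 1),
    (MvPolynomial.pderiv (R := ℂ) i).toLinearMap ∘ₗ (MvPolynomial.pderiv (R := ℂ) i).toLinearMap

/-- Restriction of a polynomial on `ℝ^{d+1}` to the sphere. -/
def restrictToSphere (d : ℕ) : MvPolynomial (Fin (d + 1)) ℂ →ₗ[ℂ] (Sph d → ℂ) where
  toFun P := fun x => MvPolynomial.eval (fun i => ((x.1 i : ℝ) : ℂ)) P
  map_add' P Q := by
    funext x
    simp
  map_smul' a P := by
    funext x
    simp

/-- `𝓗_ℓ`: the spherical harmonics of degree `ℓ`, that is, the restrictions to the sphere of the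
homogeneous harmonic polynomials of degree `ℓ`. -/
def sphHarmonics (d l : ℕ) : Submodule ℂ (Sph d → ℂ) :=
  (MvPolynomial.homogeneousSubmodule (Fin (d + 1)) ℂ l ⊓
    LinearMap.ker (polyLaplacian d)).map (restrictToSphere d)

/-- `Π_L`: the space spanned by the spherical harmonics of degree at most `L`. -/
def sphPoly (d L : ℕ) : Submodule ℂ (Sph d → ℂ) :=
  ⨆ l ∈ Finset.range (L + 1), sphHarmonics d l

/-- The number `π_L = ((d + 2L) / d) * binom (d + L - 1) L`, the dimension of `Π_L` when `d ≥ 1`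
(so that the subtraction below is not truncated). -/
def piDim (d L : ℕ) : ℝ :=
  ((d : ℝ) + 2 * L) / d * ((d + L - 1).choose L : ℝ)

/-- A triangular family of points: `m L` points of the sphere in the generation `L`, with
`m L → ∞`. -/
structure TriangularFamily (d : ℕ) where
  m : ℕ → ℕ
  pt : (L : ℕ) → Fin (m L) → Sph d
  tendsto_m : Filter.Tendsto m Filter.atTop Filter.atTop

namespace TriangularFamily

variable {d : ℕ}

/-- The data `c_{Lj}` have bounded weighted `ℓ^p` norms:
`sup_L π_L⁻¹ ∑_j |c_{Lj}|^p < ∞` for finite `p`, and `sup_{L,j} |c_{Lj}| < ∞` for `p = ∞`. -/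
def BoundedData (Z : TriangularFamily d) (p : ℝ≥0∞) (c : (L : ℕ) → Fin (Z.m L) → ℂ) : Prop :=
  (p ≠ ∞ → ∃ B : ℝ, ∀ L : ℕ, 1 / piDim d L * ∑ j, ‖c L j‖ ^ p.toReal ≤ B) ∧
  (p = ∞ → ∃ B : ℝ, ∀ (L : ℕ) (j : Fin (Z.m L)), ‖c L j‖ ≤ B)

/-- `L^p`-interpolating families: `m_L ≤ π_L`, and all bounded data are interpolated by
`Q_L ∈ Π_L` whose `L^p` norms on the sphere are bounded. -/
def IsInterpolating (Z : TriangularFamily d) (p : ℝ≥0∞) : Prop :=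
  (∀ L : ℕ, (Z.m L : ℝ) ≤ piDim d L) ∧
  ∀ c : (L : ℕ) → Fin (Z.m L) → ℂ, Z.BoundedData p c →
    ∃ Q : ℕ → Sph d → ℂ,
      (∀ L, Q L ∈ sphPoly d L) ∧
      (∀ (L : ℕ) (j : Fin (Z.m L)), Q L (Z.pt L j) = c L j) ∧
      ⨆ L, eLpNorm (Q L) p (surface d) < ∞

/-- Points of the same generation `L` are at geodesic distance at least `ε / (L + 1)`. -/
def IsUniformlySeparated (Z : TriangularFamily d) : Prop :=
  ∃ ε : ℝ, 0 < ε ∧ ∀ (L : ℕ) (j k : Fin (Z.m L)), j ≠ k →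
    ε / ((L : ℝ) + 1) ≤ geoDist (Z.pt L j) (Z.pt L k)

end TriangularFamily

end SphericalInterpolation

end

/-! Every generation gets a single spike: value `π_L ^ (1/p)` at one point of a closest pair, zero
at all other points. These data are admissible, so interpolants `Q_L` with bounded `L^p` norms
exist. Nikolskii (`exists_norm_le_of_eLpNorm_le`) gives `|Q_L| ≤ D π_L ^ (1/p)`, and Bernstein
(`norm_sub_le_geoDist`) makes `Q_L` Lipschitz with constant `7 (L + 1) D π_L ^ (1/p)`. Since `Q_L`
drops from `π_L ^ (1/p)` to `0` across the closest pair, the power cancels and `1 / (7 D (L + 1))`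
bounds the distance below. One family of data treats all generations at once, so no uniform
interpolation constant is needed.

Bernstein is reduced to great circles, hence to one complex variable. Nikolskii follows from
Bernstein: near its maximum a polynomial stays large on a cap of measure at least a constant over
`π_L`. -/

namespace SphericalInterpolation

/-! ### Bernstein's inequality on the unit circle -/

open Polynomial in
/-- Inside the unit disc a polynomial is bounded by its maximum on the unit circle. -/
theorem norm_eval_le_of_norm_le_one {R : ℂ[X]} {M : ℝ}
    (hM : ∀ z : ℂ, ‖z‖ = 1 → ‖R.eval z‖ ≤ M) {w : ℂ} (hw : ‖w‖ ≤ 1) : ‖R.eval w‖ ≤ M := by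
  refine Complex.norm_le_of_forall_mem_frontier_norm_le (f := fun z => R.eval z)
    (U := Metric.ball (0 : ℂ) 1) Metric.isBounded_ball R.differentiable.diffContOnCl ?_ ?_
  · intro z hz
    rw [frontier_ball _ one_ne_zero] at hz
    exact hM z (by simpa using hz)
  · rw [closure_ball _ one_ne_zero]
    simpa using hw

open Polynomial in
/-- Outside the unit disc a polynomial grows at most like `‖w‖ ^ N`. -/
theorem norm_eval_le_of_one_le_norm {R : ℂ[X]} {N : ℕ} (hR : R.natDegree ≤ N) {M : ℝ}
    (hM : ∀ z : ℂ, ‖z‖ = 1 → ‖R.eval z‖ ≤ M) {w : ℂ} (hw : 1 ≤ ‖w‖) :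
    ‖R.eval w‖ ≤ M * ‖w‖ ^ N := by
  -- Reflection exchanges the inside and outside of the disc and preserves the bound on the circle.
  have key : ∀ z : ℂ, z ≠ 0 → (R.reflect N).eval z⁻¹ * z ^ N = R.eval z := by
    intro z hz
    let _ : Invertible z := invertibleOfNonzero hz
    have := eval₂_reflect_mul_pow (RingHom.id ℂ) z N R hR
    rwa [invOf_eq_inv] at this
  have hw0 : w ≠ 0 := by
    rintro rfl
    norm_num at hw
  rw [← key w hw0, norm_mul, norm_pow]
  gcongr
  refine norm_eval_le_of_norm_le_one (fun z hz => ?_) ?_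
  · have hz0 : z ≠ 0 := by
      rintro rfl
      norm_num at hz
    have h := hM z⁻¹ (by simp [hz])
    rw [← key z⁻¹ (inv_ne_zero hz0), inv_inv, norm_mul] at h
    simpa [hz] using h
  · rw [norm_inv]
    exact inv_le_one_of_one_le₀ hw

open Polynomial in
/-- Bernstein's inequality on the unit circle, with constant `3`. -/
theorem norm_eval_derivative_le {R : ℂ[X]} {N : ℕ} (hR : R.natDegree ≤ N) {M : ℝ}
    (hM : ∀ z : ℂ, ‖z‖ = 1 → ‖R.eval z‖ ≤ M) {z : ℂ} (hz : ‖z‖ = 1) :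
    ‖R.derivative.eval z‖ ≤ 3 * N * M := by
  have hM0 : 0 ≤ M := (norm_nonneg _).trans (hM z hz)
  rcases Nat.eq_zero_or_pos N with rfl | hN
  · rw [natDegree_eq_zero_iff_degree_le_zero.1 (Nat.le_zero.1 hR) |> eq_C_of_degree_le_zero]
    simp
  have hN' : (0 : ℝ) < N := by exact_mod_cast hN
  have h3 : (1 + 1 / (N : ℝ)) ^ N ≤ 3 := by
    have h1 : 1 + 1 / (N : ℝ) ≤ Real.exp (1 / N) := by
      rw [add_comm]
      exact Real.add_one_le_exp _
    calc (1 + 1 / (N : ℝ)) ^ N ≤ Real.exp (1 / N) ^ N := by gcongr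
      _ = Real.exp 1 := by
        rw [← Real.exp_nat_mul]
        congr 1
        field_simp
      _ ≤ 3 := Real.exp_one_lt_three.le
  -- Cauchy's estimate at radius `1/N`, where the growth factor `(1 + 1/N) ^ N` is at most `3`.
  have h := Complex.norm_deriv_le_of_forall_mem_sphere_norm_le (f := fun w => R.eval w) (c := z)
    (R := 1 / (N : ℝ)) (C := M * 3) (by positivity) R.differentiable.diffContOnCl ?_
  · rw [Polynomial.deriv] at h
    refine h.trans (le_of_eq ?_)
    field_simp
  · intro w hw
    have hw1 : ‖w‖ ≤ 1 + 1 / (N : ℝ) := by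
      have : ‖w - z‖ = 1 / (N : ℝ) := by simpa [dist_eq_norm] using hw
      calc ‖w‖ = ‖z + (w - z)‖ := by ring_nf
        _ ≤ ‖z‖ + ‖w - z‖ := norm_add_le _ _
        _ = _ := by rw [hz, this]
    rcases le_total ‖w‖ 1 with h1 | h1
    · exact (norm_eval_le_of_norm_le_one hM h1).trans (by linarith)
    · refine (norm_eval_le_of_one_le_norm hR hM h1).trans ?_
      gcongr
      exact (pow_le_pow_left₀ (norm_nonneg _) hw1 _).trans h3

/-! ### Trigonometric polynomials -/

/-- `f` is a trigonometric polynomial of degree at most `n`. -/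
def IsTrigPoly (n : ℕ) (f : ℝ → ℂ) : Prop :=
  ∃ R : Polynomial ℂ, R.natDegree ≤ 2 * n ∧
    ∀ t : ℝ, Complex.exp (t * Complex.I) ^ n * f t = R.eval (Complex.exp (t * Complex.I))

namespace IsTrigPoly

variable {n m : ℕ} {f g : ℝ → ℂ}

theorem mono (hf : IsTrigPoly n f) (h : n ≤ m) : IsTrigPoly m f := by
  obtain ⟨R, hR, hf⟩ := hf
  refine ⟨Polynomial.X ^ (m - n) * R, Polynomial.natDegree_mul_le.trans ?_, fun t => ?_⟩
  · rw [Polynomial.natDegree_X_pow]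
    omega
  · rw [Polynomial.eval_mul, ← hf, Polynomial.eval_pow, Polynomial.eval_X, ← mul_assoc, ← pow_add,
      Nat.sub_add_cancel h]

theorem const (a : ℂ) : IsTrigPoly 0 fun _ => a :=
  ⟨Polynomial.C a, by simp, fun t => by simp⟩

theorem add (hf : IsTrigPoly n f) (hg : IsTrigPoly n g) : IsTrigPoly n fun t => f t + g t := by
  obtain ⟨R, hR, hf⟩ := hf
  obtain ⟨S, hS, hg⟩ := hg
  refine ⟨R + S, Polynomial.natDegree_add_le_of_degree_le hR hS, fun t => ?_⟩
  rw [mul_add, hf, hg, Polynomial.eval_add]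

theorem mul (hf : IsTrigPoly n f) (hg : IsTrigPoly m g) :
    IsTrigPoly (n + m) fun t => f t * g t := by
  obtain ⟨R, hR, hf⟩ := hf
  obtain ⟨S, hS, hg⟩ := hg
  refine ⟨R * S, Polynomial.natDegree_mul_le.trans (by omega), fun t => ?_⟩
  rw [Polynomial.eval_mul, ← hf, ← hg]
  ring

theorem pow (hf : IsTrigPoly n f) (k : ℕ) : IsTrigPoly (k * n) fun t => f t ^ k := by
  induction k with
  | zero => simpa using const 1
  | succ k ih =>
    simp only [pow_succ, Nat.succ_mul]
    exact ih.mul hf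

theorem sum {ι : Type*} (s : Finset ι) {F : ι → ℝ → ℂ} (h : ∀ i ∈ s, IsTrigPoly n (F i)) :
    IsTrigPoly n fun t => ∑ i ∈ s, F i t := by
  classical
  induction s using Finset.induction_on with
  | empty => simpa using (const 0).mono (Nat.zero_le n)
  | insert a s ha ih =>
    simp only [Finset.sum_insert ha]
    exact (h a (by simp)).add (ih fun i hi => h i (by simp [hi]))

theorem prod {ι : Type*} (s : Finset ι) {k : ι → ℕ} {F : ι → ℝ → ℂ}
    (h : ∀ i ∈ s, IsTrigPoly (k i) (F i)) :
    IsTrigPoly (∑ i ∈ s, k i) fun t => ∏ i ∈ s, F i t := by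
  classical
  induction s using Finset.induction_on with
  | empty => simpa using const 1
  | insert a s ha ih =>
    simp only [Finset.prod_insert ha, Finset.sum_insert ha]
    exact (h a (by simp)).mul (ih fun i hi => h i (by simp [hi]))

theorem cos_add_sin (a b : ℝ) :
    IsTrigPoly 1 fun t => ((Real.cos t * a + Real.sin t * b : ℝ) : ℂ) := by
  -- With `z = exp (it)`: `z cos t = (z² + 1)/2` and `z sin t = (z² - 1)/(2i)`.
  refine ⟨Polynomial.C ((a - Complex.I * b) / 2) * Polynomial.X ^ 2 +
    Polynomial.C ((a + Complex.I * b) / 2), ?_, fun t => ?_⟩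
  · compute_degree
  · simp only [pow_one, Complex.ofReal_add, Complex.ofReal_mul, Complex.ofReal_cos,
      Complex.ofReal_sin, Polynomial.eval_add, Polynomial.eval_mul, Polynomial.eval_C,
      Polynomial.eval_pow, Polynomial.eval_X, Complex.exp_mul_I]
    have h := Complex.sin_sq_add_cos_sq (t : ℂ)
    have hI := Complex.I_sq
    generalize Complex.cos t = c at *
    generalize Complex.sin t = s at *
    generalize Complex.I = i at *
    linear_combination ((a + i * b) / 2) * h + (b * c * s - (a - i * b) / 2 * s ^ 2) * hI

theorem eval {σ : Type*} [Fintype σ] {g : σ → ℝ → ℂ} (hg : ∀ i, IsTrigPoly 1 (g i))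
    {P : MvPolynomial σ ℂ} (hP : P.totalDegree ≤ n) :
    IsTrigPoly n fun t => MvPolynomial.eval (fun i => g i t) P := by
  simp only [MvPolynomial.eval_eq']
  refine sum _ fun k hk => ?_
  have h1 : IsTrigPoly (∑ i, k i) fun t => ∏ i, g i t ^ k i :=
    prod _ fun i _ => by simpa using (hg i).pow (k i)
  have h2 := (const (MvPolynomial.coeff k P)).mul h1
  refine h2.mono ?_
  have h3 := MvPolynomial.le_totalDegree hk
  rw [Finsupp.sum_fintype _ _ (by simp)] at h3
  omega

/-- Bernstein's inequality for trigonometric polynomials, with constant `7`. -/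
theorem norm_sub_le (hf : IsTrigPoly n f) {M : ℝ} (hM : ∀ t, ‖f t‖ ≤ M) (s t : ℝ) :
    ‖f t - f s‖ ≤ 7 * n * M * |t - s| := by
  obtain ⟨R, hR, hf⟩ := hf
  have hfe : f = fun t : ℝ => Complex.exp (t * Complex.I * (-n)) *
      R.eval (Complex.exp (t * Complex.I)) := by
    funext t
    rw [← hf, ← mul_assoc, ← Complex.exp_nat_mul, ← Complex.exp_add]
    ring_nf
    simp
  have hRM : ∀ z : ℂ, ‖z‖ = 1 → ‖R.eval z‖ ≤ M := by
    intro z hz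
    have hz' : Complex.exp (z.arg * Complex.I) = z := by
      have := Complex.norm_mul_exp_arg_mul_I z
      rwa [hz, Complex.ofReal_one, one_mul] at this
    have := hM z.arg
    have h2 := congrArg norm (hf z.arg)
    rw [hz', norm_mul, norm_pow, hz] at h2
    simpa [← h2] using this
  have hexp : ∀ t : ℝ, HasDerivAt (fun t : ℝ => Complex.exp (t * Complex.I))
      (Complex.exp (t * Complex.I) * Complex.I) t := fun t => by
    have h1 : HasDerivAt (fun t : ℝ => (t : ℂ) * Complex.I) (1 * Complex.I) t :=
      (Complex.ofRealCLM.hasDerivAt (x := t)).mul_const _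
    simpa using h1.cexp
  have hexp' : ∀ t : ℝ, HasDerivAt (fun t : ℝ => Complex.exp (t * Complex.I * (-n)))
      (Complex.exp (t * Complex.I * (-n)) * (Complex.I * (-n))) t := fun t => by
    have h1 : HasDerivAt (fun t : ℝ => (t : ℂ) * Complex.I * (-n)) (1 * Complex.I * (-n)) t :=
      ((Complex.ofRealCLM.hasDerivAt (x := t)).mul_const _).mul_const _
    simpa using h1.cexp
  have hd : ∀ t : ℝ, HasDerivAt f (Complex.exp (t * Complex.I * (-n)) * (Complex.I * (-n)) *
      R.eval (Complex.exp (t * Complex.I)) + Complex.exp (t * Complex.I * (-n)) *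
      (R.derivative.eval (Complex.exp (t * Complex.I)) *
        (Complex.exp (t * Complex.I) * Complex.I))) t := fun t => by
    rw [hfe]
    exact (hexp' t).mul ((R.hasDerivAt _).comp t (hexp t))
  -- The factor `exp (-int)` contributes `n M`, and `R`, of degree at most `2n`, contributes `3 · 2n
  -- · M`: in total `7 n M`.
  have hb := Convex.norm_image_sub_le_of_norm_hasDerivWithin_le (s := Set.univ) (C := 7 * n * M)
    (x := s) (y := t) (fun x _ => (hd x).hasDerivWithinAt) ?_ convex_univ trivial trivial
  · simpa using hb
  · intro x _
    have e1 : ‖Complex.exp (x * Complex.I)‖ = 1 := Complex.norm_exp_ofReal_mul_I x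
    have e2 : ‖Complex.exp (x * Complex.I * (-n))‖ = 1 := by
      have := Complex.norm_exp_ofReal_mul_I (x * (-n))
      rw [← this]
      push_cast
      ring_nf
    refine (norm_add_le _ _).trans ?_
    simp only [norm_mul, e1, e2, Complex.norm_I, norm_neg, Complex.norm_natCast, one_mul, mul_one]
    have h1 := hRM _ e1
    have h2 := norm_eval_derivative_le hR hRM e1
    push_cast at h2
    have h3 : (n : ℝ) * ‖R.eval (Complex.exp (x * Complex.I))‖ ≤ n * M := by gcongr
    linarith

end IsTrigPoly


/-! ### Spherical polynomials and Bernstein's inequality on the sphere -/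

open scoped Pointwise

variable {d L : ℕ}

/-- Harmonicity plays no role in the estimates; only the degree bound is kept. -/
theorem exists_mvPolynomial_of_mem_sphPoly {Q : Sph d → ℂ} (hQ : Q ∈ sphPoly d L) :
    ∃ P : MvPolynomial (Fin (d + 1)) ℂ, P.totalDegree ≤ L ∧ restrictToSphere d P = Q := by
  have h : sphPoly d L ≤
      (MvPolynomial.restrictTotalDegree (Fin (d + 1)) ℂ L).map (restrictToSphere d) := by
    refine iSup₂_le fun l hl => Submodule.map_mono fun P hP => ?_
    rw [MvPolynomial.mem_restrictTotalDegree]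
    have h1 : P.IsHomogeneous l := (MvPolynomial.mem_homogeneousSubmodule _ _).1 hP.1
    exact h1.totalDegree_le.trans (Nat.lt_succ_iff.1 (Finset.mem_range.1 hl))
  obtain ⟨P, hP, rfl⟩ := h hQ
  exact ⟨P, (MvPolynomial.mem_restrictTotalDegree _ _ _).1 hP, rfl⟩

theorem continuous_of_mem_sphPoly {Q : Sph d → ℂ} (hQ : Q ∈ sphPoly d L) : Continuous Q := by
  obtain ⟨P, -, rfl⟩ := exists_mvPolynomial_of_mem_sphPoly hQ
  change Continuous fun x : Sph d => MvPolynomial.eval (fun i => ((x.1 i : ℝ) : ℂ)) P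
  simp only [MvPolynomial.eval_eq']
  fun_prop

theorem cos_geoDist (u v : Sph d) : Real.cos (geoDist u v) =
    inner ℝ (u : EuclideanSpace ℝ (Fin (d + 1))) (v : EuclideanSpace ℝ (Fin (d + 1))) := by
  have h := abs_le.1 (abs_real_inner_le_norm (u : EuclideanSpace ℝ (Fin (d + 1))) v)
  simp only [norm_eq_of_mem_sphere, mul_one] at h
  exact Real.cos_arccos h.1 h.2

theorem dist_sq_eq (u v : Sph d) : dist u v ^ 2 = 2 - 2 * Real.cos (geoDist u v) := by
  rw [cos_geoDist, Subtype.dist_eq, dist_eq_norm, norm_sub_sq_real]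
  simp only [norm_eq_of_mem_sphere]
  ring

theorem geoDist_nonneg (u v : Sph d) : 0 ≤ geoDist u v := Real.arccos_nonneg _

/-- From `cos x ≤ 1 - 2x²/π²` on `[0, π]`, the squared chord is at least `4x²/π²`, hence at least
`x²/4` because `π ≤ 4`. -/
theorem geoDist_le_two_mul_dist (u v : Sph d) : geoDist u v ≤ 2 * dist u v := by
  have h0 := geoDist_nonneg u v
  have h1 := Real.cos_le_one_sub_mul_cos_sq (x := geoDist u v)
    (by rw [abs_of_nonneg h0]; exact Real.arccos_le_pi _)
  have h2 := dist_sq_eq u v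
  have h3 : (1 : ℝ) / 4 * geoDist u v ^ 2 ≤ 4 / Real.pi ^ 2 * geoDist u v ^ 2 := by
    gcongr ?_ * _
    rw [div_le_div_iff₀ (by norm_num) (by positivity)]
    nlinarith [Real.pi_le_four, Real.pi_pos]
  refine abs_le_of_sq_le_sq' (a := geoDist u v) (b := 2 * dist u v) ?_ (by positivity) |>.2
  have h4 : 4 / Real.pi ^ 2 * geoDist u v ^ 2 = 2 * (2 / Real.pi ^ 2 * geoDist u v ^ 2) := by ring
  linarith

/-- Two points of the sphere that are neither equal nor antipodal lie on a great circle. -/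
theorem exists_great_circle (u v : Sph d) (h0 : geoDist u v ≠ 0) (h : geoDist u v ≠ Real.pi) :
    ∃ w : EuclideanSpace ℝ (Fin (d + 1)),
      (∀ t : ℝ, ‖Real.cos t • (u : EuclideanSpace ℝ (Fin (d + 1))) + Real.sin t • w‖ = 1) ∧
      Real.cos (geoDist u v) • (u : EuclideanSpace ℝ (Fin (d + 1))) +
        Real.sin (geoDist u v) • w = v := by
  have hs : 0 < Real.sin (geoDist u v) := Real.sin_pos_of_pos_of_lt_pi
    (lt_of_le_of_ne (geoDist_nonneg u v) h0.symm) (lt_of_le_of_ne (Real.arccos_le_pi _) h)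
  have hc := cos_geoDist u v
  set s := Real.sin (geoDist u v) with hs_def
  set c := Real.cos (geoDist u v) with hc_def
  have hsc : s ^ 2 + c ^ 2 = 1 := Real.sin_sq_add_cos_sq _
  have hu : ‖(u : EuclideanSpace ℝ (Fin (d + 1)))‖ = 1 := norm_eq_of_mem_sphere u
  have hv : ‖(v : EuclideanSpace ℝ (Fin (d + 1)))‖ = 1 := norm_eq_of_mem_sphere v
  -- The normalized component of `v` orthogonal to `u`.
  refine ⟨s⁻¹ • ((v : EuclideanSpace ℝ (Fin (d + 1))) - c • u.1), fun t => ?_, ?_⟩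
  · have h1 : inner ℝ u.1 (s⁻¹ • (v.1 - c • u.1)) = 0 := by
      rw [inner_smul_right, inner_sub_right, inner_smul_right, real_inner_self_eq_norm_sq, hu, ← hc]
      ring
    have h2 : ‖s⁻¹ • (v.1 - c • u.1)‖ ^ 2 = 1 := by
      rw [norm_smul, mul_pow, norm_sub_sq_real, norm_smul, inner_smul_right, real_inner_comm, ← hc,
        hu, hv, mul_pow, Real.norm_eq_abs, Real.norm_eq_abs, sq_abs, sq_abs]
      field_simp
      linarith
    have h3 : ‖Real.cos t • u.1 + Real.sin t • (s⁻¹ • (v.1 - c • u.1))‖ ^ 2 = 1 := by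
      rw [norm_add_sq_real, norm_smul, norm_smul, inner_smul_left, inner_smul_right, h1, mul_pow,
        mul_pow, h2, hu, Real.norm_eq_abs, Real.norm_eq_abs, sq_abs, sq_abs]
      have := Real.sin_sq_add_cos_sq t
      linarith
    exact (pow_eq_one_iff_of_nonneg (norm_nonneg _) two_ne_zero).1 h3
  · rw [smul_smul, mul_inv_cancel₀ hs.ne', one_smul]
    abel

/-- Bernstein's inequality on the sphere: spherical polynomials of degree `L` are Lipschitz for the
geodesic distance. -/
theorem norm_sub_le_geoDist {Q : Sph d → ℂ} (hQ : Q ∈ sphPoly d L) {M : ℝ}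
    (hM : ∀ x, ‖Q x‖ ≤ M) (u v : Sph d) :
    ‖Q v - Q u‖ ≤ 7 * (L + 1) * M * geoDist u v := by
  have hM0 : 0 ≤ M := (norm_nonneg _).trans (hM u)
  -- For antipodal points the trivial bound `2M` suffices.
  by_cases hpi : geoDist u v = Real.pi
  · have h1 := norm_sub_le (Q v) (Q u)
    have h2 := hM u
    have h3 := hM v
    rw [hpi]
    have h4 : (1 : ℝ) * (M * 3) ≤ (L + 1) * (M * Real.pi) := by
      gcongr
      · simp
      · exact Real.pi_gt_three.le
    linarith
  obtain ⟨P, hP, rfl⟩ := exists_mvPolynomial_of_mem_sphPoly hQ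
  rcases eq_or_ne (geoDist u v) 0 with h0 | h0
  · have h1 := dist_sq_eq u v
    rw [h0, Real.cos_zero] at h1
    obtain rfl : u = v := dist_eq_zero.1 (pow_eq_zero_iff two_ne_zero |>.1 (by linarith))
    simp [h0]
  obtain ⟨w, hw, hv⟩ := exists_great_circle u v h0 hpi
  have hT := IsTrigPoly.eval (fun i => IsTrigPoly.cos_add_sin (u.1 i) (w i)) hP
  set T : ℝ → ℂ := fun t => MvPolynomial.eval
    (fun i => ((Real.cos t * u.1 i + Real.sin t * w i : ℝ) : ℂ)) P with hTdef
  have hTe : ∀ t, T t = restrictToSphere d P ⟨Real.cos t • u.1 + Real.sin t • w, by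
      simpa using hw t⟩ := fun t => by
    simp [hTdef, restrictToSphere]
  have h0 : T 0 = restrictToSphere d P u := by
    rw [hTe]
    exact congrArg _ (Subtype.ext (by simp))
  have h1 : T (geoDist u v) = restrictToSphere d P v := by
    rw [hTe]
    exact congrArg _ (Subtype.ext hv)
  have hg : 0 ≤ geoDist u v := Real.arccos_nonneg _
  have h2 := hT.norm_sub_le (fun t => by rw [hTe]; exact hM _) 0 (geoDist u v)
  rw [h0, h1, sub_zero, abs_of_nonneg hg] at h2
  refine h2.trans ?_
  gcongr
  simp

/-- Bernstein's inequality on the sphere, for the chordal distance. -/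
theorem norm_sub_le_dist {Q : Sph d → ℂ} (hQ : Q ∈ sphPoly d L) {M : ℝ}
    (hM : ∀ x, ‖Q x‖ ≤ M) (u v : Sph d) :
    ‖Q v - Q u‖ ≤ 14 * (L + 1) * M * dist u v := by
  have hM0 : 0 ≤ M := (norm_nonneg _).trans (hM u)
  calc ‖Q v - Q u‖ ≤ 7 * (L + 1) * M * geoDist u v := norm_sub_le_geoDist hQ hM u v
    _ ≤ 7 * (L + 1) * M * (2 * dist u v) := by
      gcongr
      exact geoDist_le_two_mul_dist u v
    _ = _ := by ring

/-! ### Measure of caps and growth of `π_L` -/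

/-- The cone over a cap of radius `1 / n` contains balls of radius `1 / (8 n)` along its axis. -/
theorem ball_subset_cone {n : ℕ} (hn : 0 < n) (x : Sph d) {k : ℕ} (hk : k < n) :
    Metric.ball ((1 / 2 + k / (4 * n) : ℝ) • (x : EuclideanSpace ℝ (Fin (d + 1)))) (1 / (8 * n)) ⊆
      Set.Ioo (0 : ℝ) 1 • (Subtype.val '' Metric.ball x (1 / (n : ℝ))) := by
  intro y hy
  have hn' : (1 : ℝ) ≤ n := by exact_mod_cast hn
  have hk' : (k : ℝ) / (4 * n) ≤ 1 / 4 := by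
    rw [div_le_div_iff₀ (by positivity) (by norm_num)]
    have : (k : ℝ) ≤ n := by exact_mod_cast hk.le
    linarith
  have hk0 : 0 ≤ (k : ℝ) / (4 * n) := by positivity
  set s : ℝ := 1 / 2 + k / (4 * n) with hs
  have hr : 1 / (8 * (n : ℝ)) ≤ 1 / 8 := by
    rw [div_le_div_iff₀ (by positivity) (by norm_num)]
    linarith
  have hx : ‖x.1‖ = 1 := norm_eq_of_mem_sphere x
  rw [Metric.mem_ball, dist_eq_norm] at hy
  have hsx : ‖s • x.1‖ = s := by rw [norm_smul, hx, mul_one, Real.norm_of_nonneg (by linarith)]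
  have h1 := abs_norm_sub_norm_le y (s • x.1)
  rw [hsx] at h1
  have h2 := abs_le.1 (h1.trans hy.le)
  have hy0 : 0 < ‖y‖ := by linarith
  have hy1 : ‖y‖ < 1 := by linarith
  have hyn : ‖‖y‖⁻¹ • y‖ = 1 := by
    rw [norm_smul, norm_inv, norm_norm, inv_mul_cancel₀ hy0.ne']
  refine Set.mem_smul.2 ⟨‖y‖, ⟨hy0, hy1⟩, ‖y‖⁻¹ • y, ⟨⟨‖y‖⁻¹ • y, by simpa using hyn⟩, ?_, rfl⟩, ?_⟩
  · rw [Metric.mem_ball, Subtype.dist_eq, dist_eq_norm]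
    have h3 : ‖y‖⁻¹ • y - x.1 = ‖y‖⁻¹ • ((y - s • x.1) + (s - ‖y‖) • x.1) := by
      rw [sub_smul, sub_add_sub_cancel, smul_sub, smul_smul, inv_mul_cancel₀ hy0.ne', one_smul]
    -- Both terms are at most `1/(8n)`; as `‖y‖ > 1/4`, radial projection lands within `1/n` of `x`.
    have h4 : ‖(y - s • x.1) + (s - ‖y‖) • x.1‖ ≤ 2 * (1 / (8 * n)) := by
      refine (norm_add_le _ _).trans ?_
      rw [norm_smul, hx, mul_one, Real.norm_eq_abs, abs_sub_comm]
      linarith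
    change ‖‖y‖⁻¹ • y - x.1‖ < _
    rw [h3, norm_smul, norm_inv, norm_norm, inv_mul_lt_iff₀ hy0]
    refine h4.trans_lt ?_
    have h5 : 2 * (1 / (8 * (n : ℝ))) = 1 / 4 * (1 / n) := by field_simp; norm_num
    rw [h5]
    gcongr
    linarith
  · rw [smul_smul, mul_inv_cancel₀ hy0.ne', one_smul]

/-- A cap of radius `1 / n` has surface measure at least `c / n ^ d`. -/
theorem exists_le_surface_ball (d : ℕ) : ∃ c : ℝ, 0 < c ∧ ∀ (n : ℕ), 0 < n → ∀ x : Sph d,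
    ENNReal.ofReal (c / n ^ d) ≤ surface d (Metric.ball x (1 / n)) := by
  set V := (volume : Measure (EuclideanSpace ℝ (Fin (d + 1)))).real (Metric.ball 0 1) with hV
  have hV0 : 0 < V := by
    rw [hV, measureReal_def]
    exact ENNReal.toReal_pos (Metric.measure_ball_pos _ _ one_pos).ne' measure_ball_lt_top.ne
  -- `n` disjoint balls of radius `1/(8n)` lie in the cone, with total volume `n V / (8n) ^ (d +
  -- 1)`.
  refine ⟨V / 8 ^ (d + 1), by positivity, fun n hn x => ?_⟩
  have hn' : (0 : ℝ) < n := by exact_mod_cast hn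
  have hball : ∀ y : EuclideanSpace ℝ (Fin (d + 1)), volume (Metric.ball y (1 / (8 * n))) =
      ENNReal.ofReal ((1 / (8 * n)) ^ (d + 1) * V) := by
    intro y
    rw [Measure.addHaar_ball _ _ (by positivity), finrank_euclideanSpace, Fintype.card_fin,
      ENNReal.ofReal_mul (by positivity), hV, measureReal_def,
      ENNReal.ofReal_toReal measure_ball_lt_top.ne]
  have hx : ‖x.1‖ = 1 := norm_eq_of_mem_sphere x
  have hdisj : Pairwise (Function.onFun Disjoint fun k : Fin n => Metric.ball
      ((1 / 2 + (k : ℕ) / (4 * n) : ℝ) • x.1) (1 / (8 * (n : ℝ)))) := by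
    intro k l hkl
    refine Metric.ball_disjoint_ball ?_
    rw [dist_eq_norm, ← sub_smul, norm_smul, hx, mul_one, Real.norm_eq_abs]
    have h1 : (1 / 2 + (k : ℕ) / (4 * n) : ℝ) - (1 / 2 + (l : ℕ) / (4 * n)) =
        (((k : ℕ) : ℤ) - ((l : ℕ) : ℤ) : ℤ) * (1 / (4 * n)) := by
      push_cast
      ring
    have h2 : (1 : ℝ) ≤ |((((k : ℕ) : ℤ) - ((l : ℕ) : ℤ) : ℤ) : ℝ)| := by
      rw [← Int.cast_abs]
      have : (1 : ℤ) ≤ |((k : ℕ) : ℤ) - ((l : ℕ) : ℤ)| := by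
        have := Fin.val_ne_of_ne hkl
        exact Int.one_le_abs (by omega)
      exact_mod_cast this
    rw [h1, abs_mul, abs_of_pos (by positivity : 0 < 1 / (4 * (n : ℝ)))]
    calc 1 / (8 * (n : ℝ)) + 1 / (8 * n) = 1 * (1 / (4 * n)) := by field_simp; norm_num
      _ ≤ _ := by gcongr
  calc ENNReal.ofReal (V / 8 ^ (d + 1) / n ^ d)
      = ∑ k : Fin n, volume (Metric.ball ((1 / 2 + (k : ℕ) / (4 * n) : ℝ) • x.1)
          (1 / (8 * (n : ℝ)))) := by
        simp only [hball, Finset.sum_const, Finset.card_univ, Fintype.card_fin, nsmul_eq_mul]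
        rw [← ENNReal.ofReal_natCast, ← ENNReal.ofReal_mul (by positivity)]
        congr 1
        rw [div_pow, mul_pow, pow_succ (n : ℝ)]
        field_simp
        simp
    _ = volume (⋃ k : Fin n, Metric.ball ((1 / 2 + (k : ℕ) / (4 * n) : ℝ) • x.1)
          (1 / (8 * (n : ℝ)))) := by
        rw [measure_iUnion hdisj fun _ => measurableSet_ball, tsum_fintype]
    _ ≤ volume (Set.Ioo (0 : ℝ) 1 • (Subtype.val '' Metric.ball x (1 / (n : ℝ)))) :=
        measure_mono (Set.iUnion_subset fun k => ball_subset_cone hn x k.2)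
    _ ≤ surface d (Metric.ball x (1 / n)) := by
        rw [surface, Measure.toSphere_apply' _ measurableSet_ball]
        refine le_mul_of_one_le_left' ?_
        rw [finrank_euclideanSpace, Fintype.card_fin]
        exact_mod_cast Nat.succ_pos d

/-- The degree `d` growth of the dimension of the spherical polynomials. -/
theorem exists_le_piDim (hd : 1 ≤ d) : ∃ b : ℝ, 0 < b ∧ ∀ L : ℕ, b * ((L : ℝ) + 1) ^ d ≤ piDim d L := by
  refine ⟨1 / d / (d - 1).factorial, by positivity, fun L => ?_⟩
  have h1 := Nat.pow_le_choose (α := ℝ) (d - 1) (d + L - 1)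
  rw [show d + L - 1 + 1 - (d - 1) = L + 1 by omega] at h1
  rw [show (d + L - 1).choose (d - 1) = (d + L - 1).choose L from
    Nat.choose_symm_of_eq_add (by omega)] at h1
  push_cast at h1
  have hd' : (1 : ℝ) ≤ d := by exact_mod_cast hd
  have hL : (0 : ℝ) ≤ L := by positivity
  calc 1 / d / (d - 1).factorial * ((L : ℝ) + 1) ^ d
      = (1 + L) / d * (((L : ℝ) + 1) ^ (d - 1) / (d - 1).factorial) := by
        obtain ⟨e, rfl⟩ : ∃ e, d = e + 1 := ⟨d - 1, by omega⟩
        rw [Nat.add_sub_cancel, pow_succ]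
        field_simp
        ring
    _ ≤ (d + 2 * L) / d * ((d + L - 1).choose L : ℝ) := by
        gcongr ?_ / _ * ?_
        linarith
    _ = piDim d L := rfl


/-! ### Nikolskii's inequality -/

/-- A spherical polynomial of degree `L` stays large in a cap of radius comparable to
`1 / (L + 1)` around a maximum point. -/
theorem half_le_norm_of_mem_ball {Q : Sph d → ℂ} (hQ : Q ∈ sphPoly d L) {x y : Sph d}
    (hx : ∀ z, ‖Q z‖ ≤ ‖Q x‖) (hy : y ∈ Metric.ball x (1 / (28 * (L + 1) : ℕ))) :
    ‖Q x‖ / 2 ≤ ‖Q y‖ := by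
  have h1 := norm_sub_le_dist hQ hx y x
  rw [Metric.mem_ball] at hy
  have h2 : 14 * ((L : ℝ) + 1) * ‖Q x‖ * dist y x ≤
      14 * ((L : ℝ) + 1) * ‖Q x‖ * (1 / (28 * (L + 1) : ℕ)) := by gcongr
  have h3 : 14 * ((L : ℝ) + 1) * ‖Q x‖ * (1 / (28 * (L + 1) : ℕ)) = ‖Q x‖ / 2 := by
    push_cast
    field_simp
    ring
  have h4 := norm_sub_norm_le (Q x) (Q y)
  linarith

/-- Nikolskii's inequality for spherical polynomials: the maximum is controlled by the `L^p` norm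
with a factor `π_L ^ (1 / p)`. -/
theorem exists_norm_le_of_eLpNorm_le (hd : 1 ≤ d) {p : ℝ≥0∞} (hp : 1 ≤ p) {K : ℝ} (hK : 0 ≤ K) :
    ∃ D : ℝ, 0 < D ∧ ∀ (L : ℕ) (Q : Sph d → ℂ), Q ∈ sphPoly d L →
      eLpNorm Q p (surface d) ≤ ENNReal.ofReal K →
      ∀ x, ‖Q x‖ ≤ D * piDim d L ^ (1 / p.toReal) := by
  obtain ⟨c, hc, hball⟩ := exists_le_surface_ball d
  obtain ⟨b, hb, hdim⟩ := exists_le_piDim hd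
  suffices h : ∃ D : ℝ, 0 < D ∧ ∀ (L : ℕ) (Q : Sph d → ℂ), Q ∈ sphPoly d L →
      eLpNorm Q p (surface d) ≤ ENNReal.ofReal K →
      ∀ x, (∀ z, ‖Q z‖ ≤ ‖Q x‖) → ‖Q x‖ ≤ D * piDim d L ^ (1 / p.toReal) by
    obtain ⟨D, hD, h⟩ := h
    refine ⟨D, hD, fun L Q hQ hQK x => ?_⟩
    obtain ⟨x₀, -, hx₀⟩ := isCompact_univ.exists_isMaxOn ⟨x, Set.mem_univ x⟩
      (continuous_of_mem_sphPoly hQ).norm.continuousOn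
    exact (hx₀ (Set.mem_univ x)).trans (h L Q hQ hQK x₀ fun z => hx₀ (Set.mem_univ z))
  rcases eq_or_ne p ∞ with rfl | hp'
  · refine ⟨2 * K + 1, by positivity, fun L Q hQ hQK x hx => ?_⟩
    -- Here `1 / p.toReal` is `1 / 0 = 0`, so the factor is `1`, as it should be for `p = ∞`.
    simp only [ENNReal.toReal_top, div_zero, Real.rpow_zero, mul_one]
    by_contra! hlt
    have hae : ∀ᵐ y ∂surface d, ‖Q y‖ₑ ≤ ENNReal.ofReal K := by
      rw [eLpNorm_exponent_top] at hQK
      filter_upwards [ae_le_eLpNormEssSup (f := Q) (μ := surface d)] with y hy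
      exact hy.trans hQK
    have h0 : surface d (Metric.ball x (1 / (28 * (L + 1) : ℕ))) = 0 := by
      refine measure_mono_null (fun y hy => ?_) (ae_iff.1 hae)
      have h1 := half_le_norm_of_mem_ball hQ hx hy
      simp only [Set.mem_ofPred_eq, not_le]
      rw [← ofReal_norm, ENNReal.ofReal_lt_ofReal_iff_of_nonneg hK]
      linarith
    have h1 := hball (28 * (L + 1)) (by positivity) x
    rw [h0, nonpos_iff_eq_zero, ENNReal.ofReal_eq_zero] at h1
    exact absurd h1 (not_le.2 (by positivity))
  · have hq : 0 < p.toReal := ENNReal.toReal_pos (one_pos.trans_le hp).ne' hp'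
    set q := p.toReal with hq_def
    refine ⟨2 * (28 ^ d / (c * b)) ^ (1 / q) * (K + 1), by positivity,
      fun L Q hQ hQK x hx => ?_⟩
    have hpi : 0 ≤ piDim d L := le_trans (by positivity) (hdim L)
    -- Chebyshev at half the maximum: the superlevel set contains a cap of radius `1/(28 (L + 1))`.
    have h1 := mul_meas_ge_le_pow_eLpNorm' (surface d) (one_pos.trans_le hp).ne' hp'
      (continuous_of_mem_sphPoly hQ).aestronglyMeasurable (ENNReal.ofReal (‖Q x‖ / 2))
    have h2 : ENNReal.ofReal ((‖Q x‖ / 2) ^ q * (c / (28 * (L + 1) : ℕ) ^ d)) ≤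
        ENNReal.ofReal (K ^ q) := by
      rw [ENNReal.ofReal_mul (by positivity), ← ENNReal.ofReal_rpow_of_nonneg (by positivity) hq.le,
        ← ENNReal.ofReal_rpow_of_nonneg hK hq.le]
      calc _ ≤ ENNReal.ofReal (‖Q x‖ / 2) ^ q *
            surface d {y | ENNReal.ofReal (‖Q x‖ / 2) ≤ ‖Q y‖ₑ} := by
            gcongr
            refine (hball (28 * (L + 1)) (by positivity) x).trans (measure_mono fun y hy => ?_)
            simp only [Set.mem_ofPred_eq]
            rw [← ofReal_norm]
            exact ENNReal.ofReal_le_ofReal (half_le_norm_of_mem_ball hQ hx hy)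
        _ ≤ _ := h1
        _ ≤ _ := by gcongr
    rw [ENNReal.ofReal_le_ofReal_iff (by positivity)] at h2
    have h3 : (‖Q x‖ / 2) ^ q ≤ (28 ^ d / (c * b)) * K ^ q * piDim d L := by
      calc (‖Q x‖ / 2) ^ q = (28 ^ d / (c * b)) *
            ((‖Q x‖ / 2) ^ q * (c / (28 * (L + 1) : ℕ) ^ d)) * (b * ((L : ℝ) + 1) ^ d) := by
            push_cast
            rw [mul_pow]
            field_simp
        _ ≤ _ := by
          gcongr
          exact hdim L
    have h4 := Real.rpow_le_rpow (by positivity) h3 (one_div_pos.2 hq).le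
    rw [← Real.rpow_mul (by positivity), mul_one_div_cancel hq.ne', Real.rpow_one,
      Real.mul_rpow (by positivity) hpi, Real.mul_rpow (by positivity) (by positivity),
      ← Real.rpow_mul hK, mul_one_div_cancel hq.ne', Real.rpow_one] at h4
    calc ‖Q x‖ ≤ 2 * ((28 ^ d / (c * b)) ^ (1 / q) * K * piDim d L ^ (1 / q)) := by linarith
      _ ≤ 2 * ((28 ^ d / (c * b)) ^ (1 / q) * (K + 1) * piDim d L ^ (1 / q)) := by
        gcongr
        linarith
      _ = _ := by ring

/-! ### The spike data and the conclusion -/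

/-- Data concentrated at one point of a closest pair of a finite family. -/
theorem exists_data_of_closest_pair {m : ℕ} (z : Fin m → Sph d) {a : ℝ} (ha : 0 ≤ a) :
    ∃ c : Fin m → ℂ, (∀ j, ‖c j‖ ≤ a) ∧ (∀ q : ℝ, 0 < q → ∑ j, ‖c j‖ ^ q ≤ a ^ q) ∧
      ∀ j k, j ≠ k → ∃ j' k', c j' = a ∧ c k' = 0 ∧ geoDist (z j') (z k') ≤ geoDist (z j) (z k) := by
  classical
  by_cases h : (Finset.univ : Finset (Fin m)).offDiag.Nonempty
  · obtain ⟨⟨j₀, k₀⟩, h0, hmin⟩ :=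
      Finset.exists_min_image _ (fun i : Fin m × Fin m => geoDist (z i.1) (z i.2)) h
    have hne : j₀ ≠ k₀ := (Finset.mem_offDiag.1 h0).2.2
    refine ⟨Pi.single j₀ (a : ℂ), fun j => ?_, fun q hq => ?_, fun j k hjk => ?_⟩
    · rcases eq_or_ne j j₀ with rfl | hj
      · simp [abs_of_nonneg ha]
      · simpa [hj] using ha
    · rw [Finset.sum_eq_single j₀]
      · simp [abs_of_nonneg ha]
      · intro j _ hj
        simp [hj, hq.ne']
      · simp
    · exact ⟨j₀, k₀, by simp, by simp [hne.symm],
        hmin (j, k) (Finset.mem_offDiag.2 ⟨Finset.mem_univ _, Finset.mem_univ _, hjk⟩)⟩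
  -- Fewer than two points: there is no pair to separate.
  · refine ⟨0, fun j => by simpa using ha, fun q hq => ?_, fun j k hjk => (h ⟨(j, k),
      Finset.mem_offDiag.2 ⟨Finset.mem_univ _, Finset.mem_univ _, hjk⟩⟩).elim⟩
    simpa [hq.ne'] using Real.rpow_nonneg ha q

end SphericalInterpolation

open SphericalInterpolation in
theorem mainTheorem5 (d : ℕ) (hd : 1 ≤ d) (p : ℝ≥0∞) (hp : 1 ≤ p)
    (Z : SphericalInterpolation.TriangularFamily d) (hZ : Z.IsInterpolating p) :
    Z.IsUniformlySeparated := by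
  obtain ⟨b, hb, hdim⟩ := exists_le_piDim hd
  have hpi : ∀ L, 0 < piDim d L := fun L => lt_of_lt_of_le (by positivity) (hdim L)
  have ha : ∀ L, 0 < piDim d L ^ (1 / p.toReal) := fun L => Real.rpow_pos_of_pos (hpi L) _
  choose c hc₁ hc₂ hc₃ using fun L => exists_data_of_closest_pair (Z.pt L) (ha L).le
  have hc : Z.BoundedData p c := by
    refine ⟨fun hp' => ⟨1, fun L => ?_⟩, fun hp' => ⟨1, fun L j => ?_⟩⟩
    · have hq : 0 < p.toReal := ENNReal.toReal_pos (one_pos.trans_le hp).ne' hp'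
      have h := hc₂ L p.toReal hq
      rw [← Real.rpow_mul (hpi L).le, one_div_mul_cancel hq.ne', Real.rpow_one] at h
      rw [one_div, inv_mul_le_iff₀ (hpi L), mul_one]
      exact h
    · subst hp'
      simpa using hc₁ L j
  obtain ⟨Q, hQ, hQc, hQK⟩ := hZ.2 c hc
  obtain ⟨D, hD, hnorm⟩ := exists_norm_le_of_eLpNorm_le hd hp
    (ENNReal.toReal_nonneg (a := ⨆ L, eLpNorm (Q L) p (surface d)))
  rw [ENNReal.ofReal_toReal hQK.ne] at hnorm
  refine ⟨1 / (7 * D), by positivity, fun L j k hjk => ?_⟩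
  obtain ⟨j', k', hj', hk', hle⟩ := hc₃ L j k hjk
  refine le_trans ?_ hle
  have h1 := norm_sub_le_geoDist (hQ L)
    (hnorm L (Q L) (hQ L) (le_iSup (fun L => eLpNorm (Q L) p (surface d)) L))
    (Z.pt L j') (Z.pt L k')
  rw [hQc, hQc, hj', hk', zero_sub, norm_neg, Complex.norm_real,
    Real.norm_of_nonneg (ha L).le] at h1
  -- The height of the spike cancels against the Nikolskii factor.
  have h2 : 1 ≤ 7 * ((L : ℝ) + 1) * D * geoDist (Z.pt L j') (Z.pt L k') := by
    refine le_of_mul_le_mul_right ?_ (ha L)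
    linarith
  rw [div_le_iff₀ (by positivity), div_le_iff₀ (by positivity)]
  linarith
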